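/- Let $n,m\in\mathbb N$. Let $C_{qs}(n,m)\subseteq\mathbb R^{n^2m^2}$ be the set of all tuples $(p(a,b|x,y))_{1\le x,y\le n,\,1\le a,b\le m}$ of real numbers for which there exist complex Hilbert spaces $\mathcal H_A,\mathcal H_B$, orthogonal projections $E_{x,a}\in B(\mathcal H_A)$ with $\sum_{a=1}^m E_{x,a}=I_{\mathcal H_A}$ for every $x$, orthogonal projections $F_{y,b}\in B(\mathcal H_B)$ with $\sum_{b=1}^m F_{y,b}=I_{\mathcal H_B}$ for every $y$, and a unit vector $\psi$ in the Hilbert space tensor product $\mathcal H_A\otimes\mathcal H_B$ such that \[ p(a,b|x,y)=\langle (E_{x,a}\otimes F_{y,b})\psi,\psi\rangle\qquad\text{for all } a,b,x,y. \] Let $C_q(n,m)$ be the set of those tuples for which $\mathcal H_A$ and $\mathcal H_B$ can in addition be chosen finite-dimensional. A tuple is called synchronous if $p(a,b|x,x)=0$ for all $x$ and all $a\neq b$; let $C^s_q(n,m)$ and $C^s_{qs}(n,m)$ denote the sets of synchronous elements of $C_q(n,m)$ and $C_{qs}(n,m)$, respectively. Then \[ C^s_q(n,m)=C^s_{qs}(n,m).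 \] -/

import Mathlib

open scoped TensorProduct

universe u v

noncomputable section

namespace QuantumCorrelation

/-- The Hilbert space tensor product: the completion of the algebraic tensor product of `H` and `K`
for the norm of the inner product with `⟪x ⊗ y, x' ⊗ y'⟫ = ⟪x, x'⟫ * ⟪y, y'⟫`. -/
abbrev HilbertTensor (H K : Type u)
    [NormedAddCommGroup H] [InnerProductSpace ℂ H] [NormedAddCommGroup K] [InnerProductSpace ℂ K] :
    Type u :=
  UniformSpace.Completion (H ⊗[ℂ] K)

/-- The bounded operator `S ⊗ T` on the Hilbert space tensor product: the continuous extension of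
the algebraic tensor product of the operators `S` and `T`. -/
def tensorOp {H K : Type u}
    [NormedAddCommGroup H] [InnerProductSpace ℂ H] [NormedAddCommGroup K] [InnerProductSpace ℂ K]
    (S : H →L[ℂ] H) (T : K →L[ℂ] K) : HilbertTensor H K →L[ℂ] HilbertTensor H K :=
  (TensorProduct.mapL S T).completion

/-- A family of orthogonal projections `E x a` on `H` with `∑ a, E x a = 1` for every `x`. -/
structure IsProjectiveMeasurement {n m : ℕ} {H : Type u}
    [NormedAddCommGroup H] [InnerProductSpace ℂ H] [CompleteSpace H]
    (E : Fin n → Fin m → H →L[ℂ] H) : Prop where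
  isStarProjection : ∀ x a, IsStarProjection (E x a)
  sum_eq_one : ∀ x, ∑ a, E x a = 1

/-- Tuples `p(a,b|x,y)` of real numbers, written `p a b x y`. -/
abbrev Tuple (nA nB mA mB : ℕ) : Type :=
  Fin mA → Fin mB → Fin nA → Fin nB → ℝ

/-- The tuple `p` is obtained from projective measurements on the Hilbert spaces `H`, `K` and a
unit vector `ψ` of their Hilbert space tensor product: `p(a,b|x,y) = ⟨(E x a ⊗ F y b) ψ, ψ⟩`.
(Mathlib's inner product is linear in the second variable.) -/
def IsRealizedOn (H K : Type u)
    [NormedAddCommGroup H] [InnerProductSpace ℂ H] [CompleteSpace H]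
    [NormedAddCommGroup K] [InnerProductSpace ℂ K] [CompleteSpace K]
    {nA nB mA mB : ℕ} (p : Tuple nA nB mA mB) : Prop :=
  ∃ (E : Fin nA → Fin mA → H →L[ℂ] H) (F : Fin nB → Fin mB → K →L[ℂ] K) (ψ : HilbertTensor H K),
    IsProjectiveMeasurement E ∧ IsProjectiveMeasurement F ∧ ‖ψ‖ = 1 ∧
      ∀ a b x y, (p a b x y : ℂ) = inner ℂ ψ (tensorOp (E x a) (F y b) ψ)

/-- The quantum correlations: those realised on finite-dimensional Hilbert spaces. -/
def Cq (nA nB mA mB : ℕ) : Set (Tuple nA nB mA mB) :=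
  {p | ∃ (H K : Type u)
      (_ : NormedAddCommGroup H) (_ : InnerProductSpace ℂ H) (_ : CompleteSpace H)
      (_ : NormedAddCommGroup K) (_ : InnerProductSpace ℂ K) (_ : CompleteSpace K),
      FiniteDimensional ℂ H ∧ FiniteDimensional ℂ K ∧ IsRealizedOn H K p}

/-- The quantum spatial correlations: those realised on arbitrary Hilbert spaces. -/
def Cqs (nA nB mA mB : ℕ) : Set (Tuple nA nB mA mB) :=
  {p | ∃ (H K : Type u)
      (_ : NormedAddCommGroup H) (_ : InnerProductSpace ℂ H) (_ : CompleteSpace H)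
      (_ : NormedAddCommGroup K) (_ : InnerProductSpace ℂ K) (_ : CompleteSpace K),
      IsRealizedOn H K p}

/-- A tuple is synchronous if `p(a,b|x,x) = 0` for all `x` and all `a ≠ b`. -/
def IsSynchronous {n m : ℕ} (p : Tuple n n m m) : Prop :=
  ∀ x a b, a ≠ b → p a b x x = 0

/-- The synchronous quantum correlations `C_q^s(n,m)`. -/
def syncCq (n m : ℕ) : Set (Tuple n n m m) :=
  {p | p ∈ Cq.{u} n n m m ∧ IsSynchronous p}

/-- The synchronous quantum spatial correlations `C_qs^s(n,m)`. -/
def syncCqs (n m : ℕ) : Set (Tuple n n m m) :=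
  {p | p ∈ Cqs.{u} n n m m ∧ IsSynchronous p}

end QuantumCorrelation

end

/-! Only `syncCqs ⊆ syncCq` has content. Synchronicity forces `(E x a ⊗ 1) ψ = (1 ⊗ F x a) ψ`
(`tensorOp_eq_of_isSynchronous`), so each `E x a` commutes with the reduced density operator of `ψ`
(`commute_density`). That operator is compact and symmetric, so its eigenprojections `P μ` commute
with the `E x a`, have finite rank for `μ ≠ 0`, and split `ψ` into the orthogonal sum of the vectors
`(P μ ⊗ 1) ψ`.

The correlation of `ψ` is then a convergent series of contributions of the eigenspaces, in general
infinite. It lives in a finite-dimensional real space, where the sum of a convergent series is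
already a finite nonnegative combination of its terms (`exists_finset_sum_smul_of_hasSum`).
Reweighting finitely many eigenspaces by the square roots of the coefficients gives a state with
exactly the same correlation (`exists_finiteRank_state`). Its support is finite-dimensional and
invariant, and compressing the measurements there finishes the proof
(`mem_Cq_of_finiteDimensional`). -/

namespace QuantumCorrelation

/-! ### Convergent series in finite dimension -/

section Cone

/-- In a finite-dimensional space, the sum of a convergent series is a finite nonnegative
combination of its terms. -/
theorem exists_finset_sum_smul_of_hasSum {X ι : Type*} [NormedAddCommGroup X] [NormedSpace ℝ X]
    [FiniteDimensional ℝ X] {s : ι → X} {p : X} (hs : HasSum s p) :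
    ∃ (t : Finset ι) (c : ι → ℝ), (∀ i, 0 ≤ c i) ∧ ∑ i ∈ t, c i • s i = p := by
  classical
  -- A basis of the span is picked among the terms themselves, so that the tail of the series can be
  -- absorbed into their coefficients.
  obtain ⟨κ, a, ha, hspan, hli⟩ := exists_linearIndependent' ℝ s
  have : Finite κ := hli.finite
  have := Fintype.ofFinite κ
  set V : Submodule ℝ X := Submodule.span ℝ (Set.range (s ∘ a)) with hV
  have hsV : ∀ i, s i ∈ V := fun i => by
    rw [hspan]; exact Submodule.subset_span ⟨i, rfl⟩
  have hsum : ∀ t : Finset ι, ∑ i ∈ t, s i ∈ V := fun t => V.sum_mem fun i _ => hsV i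
  have hp : p ∈ V :=
    V.closed_of_finiteDimensional.mem_of_tendsto hs (Filter.Eventually.of_forall hsum)
  let b : Module.Basis κ ℝ V := Module.Basis.span hli
  let ε : Finset ι → V := fun t => ⟨p, hp⟩ - ⟨∑ i ∈ t, s i, hsum t⟩
  have hε : Filter.Tendsto ε Filter.atTop (nhds 0) := by
    rw [tendsto_subtype_rng]
    simpa [ε] using (tendsto_const_nhds (x := p)).sub hs
  have hcoord : ∀ k, ∀ᶠ t in Filter.atTop, -1 ≤ b.repr (ε t) k := fun k => by
    have hc : Continuous (b.coord k) := LinearMap.continuous_of_finiteDimensional _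
    have h := (hc.tendsto 0).comp hε
    rw [map_zero] at h
    exact h.eventually (Ici_mem_nhds (by norm_num))
  -- `t` contains all basis terms, each with coefficient 1, and its remainder has coordinates at
  -- least `-1`; adding the remainder keeps every coefficient nonnegative.
  obtain ⟨t, hta, ht⟩ := ((Filter.eventually_ge_atTop (Finset.univ.image a)).and
    (Filter.eventually_all.2 hcoord)).exists
  refine ⟨t, fun i => 1 + Function.extend a (fun k => b.repr (ε t) k) 0 i, fun i => ?_, ?_⟩
  · by_cases h : ∃ k, a k = i
    · obtain ⟨k, rfl⟩ := h
      simp only [ha.extend_apply]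
      linarith [ht k]
    · simp [Function.extend_apply' _ _ _ h]
  · have hrest : ∑ i ∈ t, Function.extend a (fun k => b.repr (ε t) k) 0 i • s i
        = ∑ k, b.repr (ε t) k • s (a k) := by
      rw [← Finset.sum_subset hta, Finset.sum_image (ha.injOn)]
      · simp [ha.extend_apply]
      · intro i _ hi
        rw [Function.extend_apply' _ _ _ (by simpa using hi)]
        simp
    have hb : ∑ k, b.repr (ε t) k • s (a k) = p - ∑ i ∈ t, s i := by
      have hbk : ∀ k, (b k : X) = s (a k) := fun k =>
        congrArg Subtype.val (Module.Basis.span_apply hli k)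
      have h := congrArg (Subtype.val) (b.sum_repr (ε t))
      simp only [Submodule.coe_sum, Submodule.coe_smul, hbk] at h
      exact h
    simp only [add_smul, one_smul, Finset.sum_add_distrib]
    rw [hrest, hb]
    abel

end Cone

/-! ### Orthogonal projections -/

section Projections

variable {X ι : Type*} [NormedAddCommGroup X] [InnerProductSpace ℂ X] [CompleteSpace X]

theorem inner_isStarProjection {P : X →L[ℂ] X} (hP : IsStarProjection P) (x y : X) :
    inner ℂ (P x) y = inner ℂ x (P y) := by
  conv_lhs => rw [← hP.isSelfAdjoint.adjoint_eq]
  exact ContinuousLinearMap.adjoint_inner_left _ _ _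

theorem isStarProjection_apply_apply {P : X →L[ℂ] X} (hP : IsStarProjection P) (x : X) :
    P (P x) = P x :=
  congrArg (fun T : X →L[ℂ] X => T x) hP.isIdempotentElem.eq

theorem isStarProjection_inner_self {P : X →L[ℂ] X} (hP : IsStarProjection P) (x : X) :
    inner ℂ x (P x) = inner ℂ (P x) (P x) := by
  rw [inner_isStarProjection hP, isStarProjection_apply_apply hP]

/-- If no nonzero vector is annihilated by every member of a family of mutually orthogonal
projections, then every vector is the sum of its components. -/
theorem hasSum_isStarProjection {P : ι → X →L[ℂ] X} (hP : ∀ i, IsStarProjection (P i))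
    (hPP : ∀ i j, i ≠ j → P i * P j = 0) (hX : ∀ x, (∀ i, P i x = 0) → x = 0) (x : X) :
    HasSum (fun i => P i x) x := by
  have happ : ∀ i j, i ≠ j → ∀ y, P i (P j y) = 0 := fun i j hij y =>
    congrArg (fun T : X →L[ℂ] X => T y) (hPP i j hij)
  let V : ι → Submodule ℂ X := fun i => (P i).range
  have hV : OrthogonalFamily ℂ (fun i => V i) fun i => (V i).subtypeₗᵢ := by
    rintro i j hij ⟨_, v, rfl⟩ ⟨_, w, rfl⟩
    change inner ℂ (P i v) (P j w) = 0
    rw [inner_isStarProjection (hP i), happ i j hij, inner_zero_right]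
  let f : ∀ i, V i := fun i => ⟨P i x, x, rfl⟩
  -- Bessel's inequality, from Cauchy–Schwarz applied to `x` and its partial sum.
  have hbound : ∀ t : Finset ι, ∑ i ∈ t, ‖f i‖ ^ 2 ≤ ‖x‖ ^ 2 := fun t => by
    have h1 : ‖∑ i ∈ t, P i x‖ ^ 2 = ∑ i ∈ t, ‖f i‖ ^ 2 := hV.norm_sum f t
    have h2 : inner ℂ x (∑ i ∈ t, P i x) = ((∑ i ∈ t, ‖f i‖ ^ 2 : ℝ) : ℂ) := by
      rw [inner_sum]
      push_cast
      refine Finset.sum_congr rfl fun i _ => ?_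
      rw [isStarProjection_inner_self (hP i), inner_self_eq_norm_sq_to_K]
      rfl
    have h3 := norm_inner_le_norm (𝕜 := ℂ) x (∑ i ∈ t, P i x)
    rw [h2, ← h1, Complex.norm_real, Real.norm_of_nonneg (by positivity)] at h3
    rw [← h1]
    have h4 : ‖∑ i ∈ t, P i x‖ ≤ ‖x‖ := by
      by_contra! h
      nlinarith [norm_nonneg x]
    gcongr
  have hsummable : Summable fun i => P i x :=
    (hV.summable_iff_norm_sq_summable f).2
      (summable_of_sum_le (fun i => by positivity) hbound)
  obtain ⟨y, hy⟩ := hsummable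
  have hxy : x - y = 0 := hX _ fun j => by
    have h : HasSum (fun i => P j (P i x)) (P j y) := (P j).hasSum hy
    have h' : HasSum (fun i => P j (P i x)) (P j (P j x)) :=
      hasSum_single j fun i hi => happ j i hi.symm x
    rw [map_sub, h.unique h', isStarProjection_apply_apply (hP j), sub_self]
  exact (sub_eq_zero.1 hxy).symm ▸ hy

end Projections

/-! ### The Hilbert tensor product, slices and the reduced density operator -/

section Tensor

open UniformSpace ContinuousLinearMap

variable {H K : Type u}
  [NormedAddCommGroup H] [InnerProductSpace ℂ H] [NormedAddCommGroup K] [InnerProductSpace ℂ K]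

/-- The simple tensor `h ⊗ k` in the Hilbert space tensor product. -/
noncomputable def tmulL (H K : Type u)
    [NormedAddCommGroup H] [InnerProductSpace ℂ H] [NormedAddCommGroup K] [InnerProductSpace ℂ K] :
    H →L[ℂ] K →L[ℂ] HilbertTensor H K :=
  (compL ℂ K (H ⊗[ℂ] K) (HilbertTensor H K) Completion.toComplL).comp (TensorProduct.mkL ℂ H K)

theorem tmulL_apply (h : H) (k : K) :
    tmulL H K h k = ((h ⊗ₜ[ℂ] k : H ⊗[ℂ] K) : HilbertTensor H K) :=
  rfl

theorem inner_tmulL (h h' : H) (k k' : K) :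
    inner ℂ (tmulL H K h k) (tmulL H K h' k') = inner ℂ h h' * inner ℂ k k' := by
  rw [tmulL_apply, tmulL_apply, Completion.inner_coe, TensorProduct.inner_tmul]

theorem tmulL_induction {C : HilbertTensor H K → Prop} (φ : HilbertTensor H K)
    (hclosed : IsClosed {φ | C φ}) (hadd : ∀ φ χ, C φ → C χ → C (φ + χ))
    (htmul : ∀ h k, C (tmulL H K h k)) : C φ := by
  refine Completion.induction_on φ hclosed fun x => ?_
  induction x using TensorProduct.induction_on with
  | zero =>
    have h := htmul 0 0
    rw [map_zero] at h
    exact h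
  | tmul h k => exact htmul h k
  | add x y hx hy => rw [Completion.coe_add]; exact hadd _ _ hx hy

theorem ext_tmulL {X : Type*} [NormedAddCommGroup X] [NormedSpace ℂ X]
    {f g : HilbertTensor H K →L[ℂ] X} (h : ∀ x y, f (tmulL H K x y) = g (tmulL H K x y)) :
    f = g := by
  ext φ
  refine tmulL_induction φ (isClosed_eq f.continuous g.continuous) (fun φ χ hφ hχ => ?_) h
  rw [map_add, map_add, hφ, hχ]

theorem eq_of_inner_tmulL {φ χ : HilbertTensor H K}
    (h : ∀ x y, inner ℂ (tmulL H K x y) φ = inner ℂ (tmulL H K x y) χ) : φ = χ := by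
  refine ext_inner_left ℂ fun ξ => ?_
  refine tmulL_induction (C := fun ξ => inner ℂ ξ φ = inner ℂ ξ χ) ξ
    (isClosed_eq (by fun_prop) (by fun_prop)) (fun a b ha hb => ?_) h
  rw [inner_add_left, inner_add_left, ha, hb]

theorem tensorOp_tmulL (S : H →L[ℂ] H) (T : K →L[ℂ] K) (h : H) (k : K) :
    tensorOp S T (tmulL H K h k) = tmulL H K (S h) (T k) := by
  rw [tmulL_apply, tensorOp, completion_apply_coe]
  rfl

theorem tensorOp_mul (S S' : H →L[ℂ] H) (T T' : K →L[ℂ] K) :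
    tensorOp (S * S') (T * T') = tensorOp S T * tensorOp S' T' :=
  ext_tmulL fun h k => by simp [tensorOp_tmulL]

theorem tensorOp_tensorOp (S S' : H →L[ℂ] H) (T T' : K →L[ℂ] K) (φ : HilbertTensor H K) :
    tensorOp S T (tensorOp S' T' φ) = tensorOp (S * S') (T * T') φ := by
  rw [tensorOp_mul]
  rfl

theorem tensorOp_one : tensorOp (1 : H →L[ℂ] H) (1 : K →L[ℂ] K) = 1 :=
  ext_tmulL fun h k => by simp [tensorOp_tmulL]

theorem tensorOp_zero_left (T : K →L[ℂ] K) : tensorOp (0 : H →L[ℂ] H) T = 0 :=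
  ext_tmulL fun h k => by simp [tensorOp_tmulL]

theorem tensorOp_sum_left {ι : Type*} (t : Finset ι) (S : ι → H →L[ℂ] H) (T : K →L[ℂ] K) :
    tensorOp (∑ i ∈ t, S i) T = ∑ i ∈ t, tensorOp (S i) T :=
  ext_tmulL fun h k => by simp [tensorOp_tmulL]

theorem tensorOp_sum_right {ι : Type*} (t : Finset ι) (S : H →L[ℂ] H) (T : ι → K →L[ℂ] K) :
    tensorOp S (∑ i ∈ t, T i) = ∑ i ∈ t, tensorOp S (T i) :=
  ext_tmulL fun h k => by simp [tensorOp_tmulL]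

theorem tensorOp_smul_left (c : ℂ) (S : H →L[ℂ] H) (T : K →L[ℂ] K) :
    tensorOp (c • S) T = c • tensorOp S T :=
  ext_tmulL fun h k => by simp [tensorOp_tmulL]

section Slices

/-- Contraction of a tensor with a vector of the first factor. -/
noncomputable def sliceLeft (H K : Type u) [NormedAddCommGroup H] [InnerProductSpace ℂ H]
    [NormedAddCommGroup K] [InnerProductSpace ℂ K] [CompleteSpace K] :
    HilbertTensor H K →L[ℂ] H →L⋆[ℂ] K :=
  (((adjoint (𝕜 := ℂ) (E := K) (F := HilbertTensor H K)).toContinuousLinearEquiv :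
    (K →L[ℂ] HilbertTensor H K) →L⋆[ℂ] HilbertTensor H K →L[ℂ] K).comp (tmulL H K)).flip

theorem inner_sliceLeft [CompleteSpace K] (φ : HilbertTensor H K) (h : H) (k : K) :
    inner ℂ k (sliceLeft H K φ h) = inner ℂ (tmulL H K h k) φ :=
  adjoint_inner_right (tmulL H K h) k φ

theorem eq_zero_of_sliceLeft [CompleteSpace K] {φ : HilbertTensor H K}
    (h : ∀ x, sliceLeft H K φ x = 0) : φ = 0 :=
  eq_of_inner_tmulL fun x y => by rw [← inner_sliceLeft, h, inner_zero_right, inner_zero_right]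

/-- Contraction of a tensor with a vector of the second factor. -/
noncomputable def sliceRight (H K : Type u) [NormedAddCommGroup H] [InnerProductSpace ℂ H]
    [NormedAddCommGroup K] [InnerProductSpace ℂ K] [CompleteSpace H] :
    HilbertTensor H K →L[ℂ] K →L⋆[ℂ] H :=
  (((adjoint (𝕜 := ℂ) (E := H) (F := HilbertTensor H K)).toContinuousLinearEquiv :
    (H →L[ℂ] HilbertTensor H K) →L⋆[ℂ] HilbertTensor H K →L[ℂ] H).comp (tmulL H K).flip).flip

theorem inner_sliceRight [CompleteSpace H] (φ : HilbertTensor H K) (h : H) (k : K) :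
    inner ℂ h (sliceRight H K φ k) = inner ℂ (tmulL H K h k) φ :=
  adjoint_inner_right ((tmulL H K).flip k) h φ

theorem sliceRight_tmulL [CompleteSpace H] (h : H) (k k' : K) :
    sliceRight H K (tmulL H K h k) k' = inner ℂ k' k • h :=
  ext_inner_left ℂ fun y => by rw [inner_sliceRight, inner_tmulL, inner_smul_right, mul_comm]

/-- A simple tensor gives a slice of rank at most one. Compact operators are closed under sums and
norm limits, and the slice depends continuously on the tensor. -/
theorem isCompactOperator_sliceRight [CompleteSpace H] (φ : HilbertTensor H K) :
    IsCompactOperator (sliceRight H K φ) := by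
  refine tmulL_induction (C := fun φ => IsCompactOperator (sliceRight H K φ)) φ
    (isClosed_setOfPred_isCompactOperator.preimage (sliceRight H K).continuous)
    (fun φ χ hφ hχ => ?_) fun h k => ?_
  · rw [map_add]
    exact hφ.add hχ
  · have hf : IsCompactOperator fun k' : K => (starRingEnd ℂ) (inner ℂ k k') :=
      (isCompactOperator_of_locallyCompactSpace_dom (innerSL ℂ k)).continuous_comp
        Complex.continuous_conj
    have hg := hf.continuous_comp (g := fun c : ℂ => c • h) (by fun_prop)
    have heq : ⇑(sliceRight H K (tmulL H K h k))
        = (fun c : ℂ => c • h) ∘ fun k' : K => (starRingEnd ℂ) (inner ℂ k k') := by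
      ext k'
      simp [sliceRight_tmulL]
    rwa [heq]

end Slices

variable [CompleteSpace H] [CompleteSpace K]

theorem adjoint_tensorOp (S : H →L[ℂ] H) (T : K →L[ℂ] K) :
    adjoint (tensorOp S T) = tensorOp (adjoint S) (adjoint T) :=
  ext_tmulL fun h k => eq_of_inner_tmulL fun x y => by
    rw [adjoint_inner_right, tensorOp_tmulL, tensorOp_tmulL, inner_tmulL, inner_tmulL,
      adjoint_inner_right, adjoint_inner_right]

theorem isStarProjection_tensorOp {S : H →L[ℂ] H} {T : K →L[ℂ] K} (hS : IsStarProjection S)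
    (hT : IsStarProjection T) : IsStarProjection (tensorOp S T) where
  isIdempotentElem := by
    rw [IsIdempotentElem, ← tensorOp_mul, hS.isIdempotentElem.eq, hT.isIdempotentElem.eq]
  isSelfAdjoint := by
    rw [IsSelfAdjoint, star_eq_adjoint, adjoint_tensorOp, hS.isSelfAdjoint.adjoint_eq,
      hT.isSelfAdjoint.adjoint_eq]

theorem sliceLeft_tensorOp (S : H →L[ℂ] H) (T : K →L[ℂ] K) (φ : HilbertTensor H K) (h : H) :
    sliceLeft H K (tensorOp S T φ) h = T (sliceLeft H K φ (adjoint S h)) :=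
  ext_inner_left ℂ fun y => by
    rw [inner_sliceLeft, ← adjoint_inner_left, adjoint_tensorOp, tensorOp_tmulL, ← inner_sliceLeft,
      adjoint_inner_left]

/-- The reduced density operator of a tensor on the first factor. -/
noncomputable def density (φ : HilbertTensor H K) : H →L[ℂ] H :=
  (sliceRight H K φ).comp (sliceLeft H K φ)

theorem inner_density (φ : HilbertTensor H K) (x y : H) :
    inner ℂ x (density φ y) = inner ℂ (sliceLeft H K φ y) (sliceLeft H K φ x) := by
  rw [inner_sliceLeft]
  exact inner_sliceRight φ x _

theorem isCompactOperator_density (φ : HilbertTensor H K) : IsCompactOperator (density φ) :=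
  (isCompactOperator_sliceRight φ).comp_clm _

theorem isSymmetric_density (φ : HilbertTensor H K) : (density φ).IsSymmetric := fun x y => by
  change inner ℂ (density φ x) y = inner ℂ x (density φ y)
  rw [← inner_conj_symm, inner_density, inner_density, inner_conj_symm]

theorem sliceLeft_eq_zero_of_density {φ : HilbertTensor H K} {x : H} (h : density φ x = 0) :
    sliceLeft H K φ x = 0 := by
  rw [← inner_self_eq_zero (𝕜 := ℂ), ← inner_density, h, inner_zero_right]

/-- The hypothesis says that the slice map intertwines `S` and `T`. The density operator is the Gram
operator of the slice map, and `T` moves across the inner product because it is self-adjoint. -/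
theorem commute_density {φ : HilbertTensor H K} {S : H →L[ℂ] H} {T : K →L[ℂ] K}
    (hS : IsSelfAdjoint S) (hT : IsSelfAdjoint T) (h : tensorOp S 1 φ = tensorOp 1 T φ) :
    Commute S (density φ) := by
  have hslice : ∀ x, sliceLeft H K φ (S x) = T (sliceLeft H K φ x) := fun x => by
    have h1 := sliceLeft_tensorOp S 1 φ x
    have h2 := sliceLeft_tensorOp 1 T φ x
    rw [hS.adjoint_eq] at h1
    rw [← h, h1] at h2
    simpa [← star_eq_adjoint] using h2
  refine ContinuousLinearMap.ext fun x => ext_inner_left ℂ fun y => ?_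
  change inner ℂ y (S (density φ x)) = inner ℂ y (density φ (S x))
  rw [inner_density, hslice, ← adjoint_inner_left, hS.adjoint_eq, inner_density, hslice,
    ← adjoint_inner_left, hT.adjoint_eq]

end Tensor

/-! ### Compression to finite-dimensional invariant subspaces -/

section Realization

open UniformSpace ContinuousLinearMap

variable {H K : Type u}
  [NormedAddCommGroup H] [InnerProductSpace ℂ H] [NormedAddCommGroup K] [InnerProductSpace ℂ K]

/-- The index type may be taken in any universe `v`; this is what makes the universes on the two
sides of the final equality independent. -/
theorem exists_linearIsometry_range {V : Submodule ℂ H} [FiniteDimensional ℂ V] :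
    ∃ (ι : Type v) (_ : Fintype ι) (J : EuclideanSpace ℂ ι →ₗᵢ[ℂ] H), J.toLinearMap.range = V := by
  let b := (stdOrthonormalBasis ℂ V).reindex Equiv.ulift.{v}.symm
  refine ⟨_, inferInstance, V.subtypeₗᵢ.comp b.repr.symm.toLinearIsometry, ?_⟩
  ext x
  constructor
  · rintro ⟨y, rfl⟩
    exact (b.repr.symm y).2
  · intro hx
    exact ⟨b.repr ⟨x, hx⟩, by simp⟩

variable [CompleteSpace H] [CompleteSpace K]

/-- A state supported on a finite-dimensional `V` is thus a finite sum of simple tensors, hence lies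
in the algebraic tensor product. -/
theorem tensorOp_starProjection {ι : Type*} [Fintype ι] {V : Submodule ℂ H}
    [V.HasOrthogonalProjection] (b : OrthonormalBasis ι ℂ V) (φ : HilbertTensor H K) :
    tensorOp V.starProjection 1 φ = ∑ i, tmulL H K (b i : H) (sliceLeft H K φ (b i : H)) := by
  refine eq_of_inner_tmulL fun x y => ?_
  have hx : V.starProjection x = ∑ i, inner ℂ (b i : H) x • (b i : H) := by
    rw [b.starProjection_eq_sum_rankOne]
    simp
  rw [← inner_sliceLeft, sliceLeft_tensorOp, (isSelfAdjoint_starProjection V).adjoint_eq, hx,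
    inner_sum, map_sum]
  change inner ℂ y (∑ i, sliceLeft H K φ (inner ℂ (b i : H) x • (b i : H))) = _
  rw [inner_sum]
  refine Finset.sum_congr rfl fun i _ => ?_
  rw [map_smulₛₗ, inner_smul_right, inner_tmulL, inner_conj_symm]

section Compression

variable {H₀ : Type v} [NormedAddCommGroup H₀] [InnerProductSpace ℂ H₀] [CompleteSpace H₀]

/-- The compression of an operator along an isometry. -/
noncomputable def compression (J : H₀ →ₗᵢ[ℂ] H) (T : H →L[ℂ] H) : H₀ →L[ℂ] H₀ :=
  (adjoint J.toContinuousLinearMap).comp (T.comp J.toContinuousLinearMap)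

theorem adjoint_isometry_apply (J : H₀ →ₗᵢ[ℂ] H) (x : H₀) :
    adjoint J.toContinuousLinearMap (J x) = x :=
  ext_inner_left ℂ fun y => by
    rw [adjoint_inner_right]
    exact J.inner_map_map y x

theorem isometry_compression_apply {J : H₀ →ₗᵢ[ℂ] H} {T : H →L[ℂ] H}
    (h : ∀ x ∈ J.toLinearMap.range, T x ∈ J.toLinearMap.range) (x : H₀) :
    J (compression J T x) = T (J x) := by
  obtain ⟨y, hy⟩ := h (J x) ⟨x, rfl⟩
  change J (adjoint J.toContinuousLinearMap (T (J x))) = T (J x)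
  rw [← hy]
  exact congrArg J (adjoint_isometry_apply J y)

theorem isProjectiveMeasurement_compression {n m : ℕ} {E : Fin n → Fin m → H →L[ℂ] H}
    (hE : IsProjectiveMeasurement E) {J : H₀ →ₗᵢ[ℂ] H}
    (h : ∀ x a, ∀ z ∈ J.toLinearMap.range, E x a z ∈ J.toLinearMap.range) :
    IsProjectiveMeasurement fun x a => compression J (E x a) where
  isStarProjection x a :=
    { isIdempotentElem := by
        ext z
        apply J.injective
        change J (compression J (E x a) (compression J (E x a) z)) = _
        rw [isometry_compression_apply (h x a), isometry_compression_apply (h x a),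
          isStarProjection_apply_apply (hE.isStarProjection x a)]
      isSelfAdjoint := by
        rw [IsSelfAdjoint, star_eq_adjoint, compression, adjoint_comp, adjoint_comp,
          adjoint_adjoint, (hE.isStarProjection x a).isSelfAdjoint.adjoint_eq]
        rfl }
  sum_eq_one x := by
    ext z
    apply J.injective
    have h1 := congrArg (fun T : H →L[ℂ] H => T (J z)) (hE.sum_eq_one x)
    simp only [sum_apply] at h1
    simp only [sum_apply, map_sum, isometry_compression_apply (h x _), h1]
    rfl

end Compression

variable {H₀ K₀ : Type v} [NormedAddCommGroup H₀] [InnerProductSpace ℂ H₀] [CompleteSpace H₀]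
  [NormedAddCommGroup K₀] [InnerProductSpace ℂ K₀] [CompleteSpace K₀]

/-- A correlation whose state lies in the tensor product of two invariant subspaces is realised on
these subspaces. -/
theorem isRealizedOn_of_isometry {nA nB mA mB : ℕ} {p : Tuple nA nB mA mB}
    {E : Fin nA → Fin mA → H →L[ℂ] H} {F : Fin nB → Fin mB → K →L[ℂ] K}
    (hE : IsProjectiveMeasurement E) (hF : IsProjectiveMeasurement F)
    (J : H₀ →ₗᵢ[ℂ] H) (L : K₀ →ₗᵢ[ℂ] K)
    (hJ : ∀ x a, ∀ z ∈ J.toLinearMap.range, E x a z ∈ J.toLinearMap.range)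
    (hL : ∀ y b, ∀ z ∈ L.toLinearMap.range, F y b z ∈ L.toLinearMap.range)
    (t : H₀ ⊗[ℂ] K₀)
    (hnorm : ‖((TensorProduct.map J.toLinearMap L.toLinearMap t : H ⊗[ℂ] K) :
      HilbertTensor H K)‖ = 1)
    (hp : ∀ a b x y, (p a b x y : ℂ) =
      inner ℂ ((TensorProduct.map J.toLinearMap L.toLinearMap t : H ⊗[ℂ] K) : HilbertTensor H K)
        (tensorOp (E x a) (F y b)
          ((TensorProduct.map J.toLinearMap L.toLinearMap t : H ⊗[ℂ] K) : HilbertTensor H K))) :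
    IsRealizedOn H₀ K₀ p := by
  refine ⟨fun x a => compression J (E x a), fun y b => compression L (F y b),
    (t : HilbertTensor _ _),
    isProjectiveMeasurement_compression hE hJ, isProjectiveMeasurement_compression hF hL, ?_,
    fun a b x y => ?_⟩
  · rwa [Completion.norm_coe, TensorProduct.norm_map, ← Completion.norm_coe] at hnorm
  · rw [hp, tensorOp, tensorOp, completion_apply_coe, completion_apply_coe, Completion.inner_coe,
      Completion.inner_coe, ← TensorProduct.inner_map_map J L]
    congr 1
    clear hp hnorm
    induction t using TensorProduct.induction_on with
    | zero => simp
    | tmul h k =>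
      simp only [TensorProduct.mapL_tmul, TensorProduct.map_tmul]
      change E x a (J h) ⊗ₜ[ℂ] F y b (L k) = J _ ⊗ₜ[ℂ] L _
      rw [isometry_compression_apply (hJ x a), isometry_compression_apply (hL y b)]
    | add s t hs ht => simp only [map_add, hs, ht]

/-- A correlation whose state is supported on a finite-dimensional invariant subspace of the first
factor, and on which the two measurements agree, is realised in finite dimension. -/
theorem mem_Cq_of_finiteDimensional {n m : ℕ} {p : Tuple n n m m}
    {E : Fin n → Fin m → H →L[ℂ] H} {F : Fin n → Fin m → K →L[ℂ] K}
    (hE : IsProjectiveMeasurement E) (hF : IsProjectiveMeasurement F)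
    (V : Submodule ℂ H) [FiniteDimensional ℂ V] (hV : ∀ x a, ∀ z ∈ V, E x a z ∈ V)
    {φ : HilbertTensor H K} (hφ : tensorOp V.starProjection 1 φ = φ) (hnorm : ‖φ‖ = 1)
    (hEF : ∀ x a, tensorOp (E x a) 1 φ = tensorOp 1 (F x a) φ)
    (hp : ∀ a b x y, (p a b x y : ℂ) = inner ℂ φ (tensorOp (E x a) (F y b) φ)) :
    p ∈ Cq.{v} n n m m := by
  -- The support of `φ` in the second factor. It is `F`-invariant because `hEF` makes the slice map
  -- intertwine `E` and `F`.
  let W : Submodule ℂ K := V.map (sliceLeft H K φ).toLinearMap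
  have hW : ∀ y b, ∀ z ∈ W, F y b z ∈ W := by
    rintro y b _ ⟨z, hz, rfl⟩
    refine ⟨E y b z, hV y b z hz, ?_⟩
    have h1 := sliceLeft_tensorOp (E y b) 1 φ z
    have h2 := sliceLeft_tensorOp 1 (F y b) φ z
    rw [(hE.isStarProjection y b).isSelfAdjoint.adjoint_eq] at h1
    rw [← hEF, h1] at h2
    simpa [← star_eq_adjoint] using h2
  obtain ⟨ι, _, J, hJ⟩ := exists_linearIsometry_range.{u, v} (V := V)
  obtain ⟨κ, _, L, hL⟩ := exists_linearIsometry_range.{u, v} (V := W)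
  have ht : ∃ t : EuclideanSpace ℂ ι ⊗[ℂ] EuclideanSpace ℂ κ,
      ((TensorProduct.map J.toLinearMap L.toLinearMap t : H ⊗[ℂ] K) : HilbertTensor H K) = φ := by
    let b := stdOrthonormalBasis ℂ V
    have hj : ∀ i, ∃ x, J x = (b i : H) := fun i => by
      have h : (b i : H) ∈ J.toLinearMap.range := hJ ▸ (b i).2
      exact h
    have hl : ∀ i, ∃ x, L x = sliceLeft H K φ (b i : H) := fun i => by
      have h : sliceLeft H K φ (b i : H) ∈ L.toLinearMap.range := hL ▸ ⟨_, (b i).2, rfl⟩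
      exact h
    choose f hf using hj
    choose g hg using hl
    refine ⟨∑ i, f i ⊗ₜ g i, ?_⟩
    rw [← Completion.coe_toComplL (𝕜 := ℂ)]
    conv_rhs => rw [← hφ, tensorOp_starProjection b]
    simp only [map_sum, TensorProduct.map_tmul]
    refine Finset.sum_congr rfl fun i _ => ?_
    rw [tmulL_apply, ← hg, ← hf]
    rfl
  obtain ⟨t, rfl⟩ := ht
  exact ⟨EuclideanSpace ℂ ι, EuclideanSpace ℂ κ, inferInstance, inferInstance, inferInstance,
    inferInstance, inferInstance, inferInstance, inferInstance, inferInstance,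
    isRealizedOn_of_isometry hE hF J L (by rwa [hJ]) (by rwa [hL]) t hnorm hp⟩

end Realization

/-! ### Spectral decomposition of the reduced density operator -/

section Spectral

open ContinuousLinearMap

variable {H K : Type u}
  [NormedAddCommGroup H] [InnerProductSpace ℂ H] [NormedAddCommGroup K] [InnerProductSpace ℂ K]
  [CompleteSpace H] [CompleteSpace K]

instance completeSpace_eigenspace (T : H →L[ℂ] H) (μ : ℂ) :
    CompleteSpace (Module.End.eigenspace (T : Module.End ℂ H) μ) := by
  have h : (Module.End.eigenspace (T : Module.End ℂ H) μ : Set H) = {x | T x = μ • x} := by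
    ext x
    exact Module.End.mem_eigenspace_iff
  refine IsClosed.completeSpace_coe (hs := ?_)
  rw [h]
  exact isClosed_eq T.continuous (continuous_const_smul μ)

/-- The projection onto an eigenspace of the reduced density operator. -/
noncomputable def densityProj (φ : HilbertTensor H K) (μ : ℂ) : H →L[ℂ] H :=
  (Module.End.eigenspace (density φ : Module.End ℂ H) μ).starProjection

theorem isStarProjection_densityProj (φ : HilbertTensor H K) (μ : ℂ) :
    IsStarProjection (densityProj φ μ) :=
  isStarProjection_starProjection

theorem densityProj_mul_of_ne (φ : HilbertTensor H K) {μ ν : ℂ} (h : μ ≠ ν) :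
    densityProj φ μ * densityProj φ ν = 0 := by
  ext x
  refine ext_inner_left ℂ fun y => ?_
  change inner ℂ y (densityProj φ μ (densityProj φ ν x)) = inner ℂ y 0
  rw [← inner_isStarProjection (isStarProjection_densityProj φ μ), inner_zero_right]
  exact (isSymmetric_density φ).orthogonalFamily_eigenspaces h
    ⟨_, Submodule.starProjection_apply_mem _ y⟩ ⟨_, Submodule.starProjection_apply_mem _ x⟩

theorem commute_densityProj {φ : HilbertTensor H K} {S : H →L[ℂ] H} {T : K →L[ℂ] K}
    (hS : IsSelfAdjoint S) (hT : IsSelfAdjoint T) (h : tensorOp S 1 φ = tensorOp 1 T φ) (μ : ℂ) :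
    Commute S (densityProj φ μ) := by
  have hcomm := commute_density hS hT h
  have hmaps : ∀ x, densityProj φ μ (S (densityProj φ μ x)) = S (densityProj φ μ x) := fun x => by
    refine Submodule.starProjection_eq_self_iff.2 (Module.End.mem_eigenspace_iff.2 ?_)
    have hx := Module.End.mem_eigenspace_iff.1 (Submodule.starProjection_apply_mem
      (Module.End.eigenspace (density φ : Module.End ℂ H) μ) x)
    change density φ (S (densityProj φ μ x)) = μ • S (densityProj φ μ x)
    rw [← map_smul]
    exact (congrArg (fun R : H →L[ℂ] H => R (densityProj φ μ x)) hcomm.eq).symm.trans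
      (congrArg S hx)
  have h1 : densityProj φ μ * S * densityProj φ μ = S * densityProj φ μ := by
    ext x
    exact hmaps x
  -- The adjoint of `P S P = S P` reads `P S P = P S`; comparing the two gives commutation.
  have h2 := congrArg star h1
  rw [star_mul, star_mul, star_mul, hS.star_eq,
    (isStarProjection_densityProj φ μ).isSelfAdjoint.star_eq, ← mul_assoc, h1] at h2
  exact h2

theorem finiteDimensional_range_densityProj (φ : HilbertTensor H K) {μ : ℂ} (h : μ ≠ 0) :
    FiniteDimensional ℂ (densityProj φ μ).range := by
  have := finite_dimensional_eigenspace (isCompactOperator_density φ) μ h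
  rw [densityProj, Submodule.range_starProjection]
  exact this

theorem tensorOp_densityProj_zero (φ : HilbertTensor H K) : tensorOp (densityProj φ 0) 1 φ = 0 :=
  eq_zero_of_sliceLeft fun x => by
    rw [sliceLeft_tensorOp, (isStarProjection_densityProj φ 0).isSelfAdjoint.adjoint_eq]
    apply sliceLeft_eq_zero_of_density
    have hx := Module.End.mem_eigenspace_iff.1 (Submodule.starProjection_apply_mem
      (Module.End.eigenspace (density φ : Module.End ℂ H) 0) x)
    rw [zero_smul] at hx
    exact hx

/-- If all `P μ ⊗ 1` kill `ξ`, the slice map of `ξ` vanishes on every eigenspace. These span a dense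
subspace by the spectral theorem for compact symmetric operators, so `ξ = 0`. -/
theorem hasSum_tensorOp_densityProj (φ χ : HilbertTensor H K) :
    HasSum (fun μ => tensorOp (densityProj φ μ) 1 χ) χ := by
  refine hasSum_isStarProjection (P := fun μ => tensorOp (densityProj φ μ) (1 : K →L[ℂ] K))
    (fun μ => isStarProjection_tensorOp (isStarProjection_densityProj φ μ) (.one _))
    (fun μ ν h => ?_) (fun ξ h => eq_zero_of_sliceLeft fun x => ?_) χ
  · rw [← tensorOp_mul, densityProj_mul_of_ne φ h, tensorOp_zero_left]
  · have hle : ⨆ μ, Module.End.eigenspace (density φ : Module.End ℂ H) μ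
        ≤ LinearMap.ker (sliceLeft H K ξ).toLinearMap := iSup_le fun μ y hy => by
      have hy' : densityProj φ μ y = y := Submodule.starProjection_eq_self_iff.2 hy
      have h1 := sliceLeft_tensorOp (densityProj φ μ) 1 ξ y
      rw [h μ, (isStarProjection_densityProj φ μ).isSelfAdjoint.adjoint_eq, hy', map_zero] at h1
      exact h1.symm
    have hclosed : IsClosed (LinearMap.ker (sliceLeft H K ξ).toLinearMap : Set H) :=
      isClosed_eq (sliceLeft H K ξ).continuous continuous_const
    have htop := (Submodule.topologicalClosure_eq_top_iff).2
      (orthogonalComplement_iSup_eigenspaces_eq_bot (isCompactOperator_density φ)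
        (isSymmetric_density φ))
    exact Submodule.topologicalClosure_minimal _ hle hclosed (htop ▸ Submodule.mem_top)

end Spectral

/-! ### Synchronous correlations -/

section Synchronous

open ContinuousLinearMap

variable {H K : Type u}
  [NormedAddCommGroup H] [InnerProductSpace ℂ H] [NormedAddCommGroup K] [InnerProductSpace ℂ K]
  [CompleteSpace H] [CompleteSpace K]

/-- On the state of a synchronous correlation the two measurements act in the same way. -/
theorem tensorOp_eq_of_isSynchronous {n m : ℕ} {p : Tuple n n m m} (hp : IsSynchronous p)
    {E : Fin n → Fin m → H →L[ℂ] H} {F : Fin n → Fin m → K →L[ℂ] K} {ψ : HilbertTensor H K}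
    (hE : IsProjectiveMeasurement E) (hF : IsProjectiveMeasurement F)
    (h : ∀ a b x y, (p a b x y : ℂ) = inner ℂ ψ (tensorOp (E x a) (F y b) ψ))
    (x : Fin n) (a : Fin m) : tensorOp (E x a) 1 ψ = tensorOp 1 (F x a) ψ := by
  have hzero : ∀ a b, a ≠ b → tensorOp (E x a) (F x b) ψ = 0 := fun a b hab => by
    have h0 := h a b x x
    rw [hp x a b hab, isStarProjection_inner_self (isStarProjection_tensorOp
      (hE.isStarProjection x a) (hF.isStarProjection x b)), Complex.ofReal_zero] at h0
    exact inner_self_eq_zero.1 h0.symm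
  -- Resolving both identities leaves only the diagonal term `(E x a ⊗ F x a) ψ` on each side.
  rw [← hF.sum_eq_one x, ← hE.sum_eq_one x, tensorOp_sum_right, tensorOp_sum_left, sum_apply,
    sum_apply, Finset.sum_eq_single a (fun b _ hb => hzero a b hb.symm) (by simp),
    Finset.sum_eq_single a (fun b _ hb => hzero b a hb) (by simp)]

/-- A state whose correlation is synchronous can be replaced by a state supported on finitely many
eigenspaces of its reduced density operator. -/
theorem exists_finiteRank_state {n m : ℕ} {E : Fin n → Fin m → H →L[ℂ] H}
    {F : Fin n → Fin m → K →L[ℂ] K} {ψ : HilbertTensor H K}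
    (hE : IsProjectiveMeasurement E) (hF : IsProjectiveMeasurement F)
    (hEF : ∀ x a, tensorOp (E x a) 1 ψ = tensorOp 1 (F x a) ψ) :
    ∃ A : H →L[ℂ] H, FiniteDimensional ℂ A.range ∧ (∀ x a, Commute (E x a) A) ∧
      ‖tensorOp A 1 ψ‖ = ‖ψ‖ ∧
      ∀ a b x y, inner ℂ (tensorOp A 1 ψ) (tensorOp (E x a) (F y b) (tensorOp A 1 ψ)) =
        inner ℂ ψ (tensorOp (E x a) (F y b) ψ) := by
  classical
  let P := densityProj ψ
  have hcomm : ∀ x a μ, Commute (E x a) (P μ) := fun x a μ =>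
    commute_densityProj (hE.isStarProjection x a).isSelfAdjoint
      (hF.isStarProjection x a).isSelfAdjoint (hEF x a) μ
  -- The last coordinate records the squared norm, so that the new state is again a unit vector when
  -- `ψ` is.
  let s : ℂ → (Fin m → Fin m → Fin n → Fin n → ℂ) × ℂ := fun μ =>
    (fun a b x y => inner ℂ ψ (tensorOp (E x a) (F y b) (tensorOp (P μ) 1 ψ)),
      inner ℂ ψ (tensorOp (P μ) 1 ψ))
  have hsum : HasSum s (fun a b x y => inner ℂ ψ (tensorOp (E x a) (F y b) ψ), inner ℂ ψ ψ) := by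
    have h := hasSum_tensorOp_densityProj ψ ψ
    refine HasSum.prodMk ?_ ((innerSL ℂ ψ).hasSum h)
    simp only [Pi.hasSum]
    exact fun a b x y => (innerSL ℂ ψ).hasSum ((tensorOp (E x a) (F y b)).hasSum h)
  obtain ⟨t, c, hc, hsc⟩ := exists_finset_sum_smul_of_hasSum hsum
  -- The eigenvalue 0, whose eigenspace may be infinite-dimensional, contributes nothing and can be
  -- dropped.
  have hs0 : s 0 = 0 := by
    simp only [s, P, tensorOp_densityProj_zero, map_zero, inner_zero_right]
    rfl
  have hsc' : ∑ μ ∈ t.erase 0, c μ • s μ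
      = (fun a b x y => inner ℂ ψ (tensorOp (E x a) (F y b) ψ), inner ℂ ψ ψ) := by
    rw [Finset.sum_erase _ (by rw [hs0, smul_zero])]
    exact hsc
  -- Square roots, since `A` enters the correlation quadratically: `A * A` has the coefficients `c
  -- μ`.
  let A : H →L[ℂ] H := ∑ μ ∈ t.erase 0, ((√(c μ) : ℝ) : ℂ) • P μ
  have hEA : ∀ x a, Commute (E x a) A := fun x a =>
    Commute.sum_right _ _ _ fun μ _ => (hcomm x a μ).smul_right _
  have hA : adjoint A = A := by
    rw [map_sum]
    refine Finset.sum_congr rfl fun μ _ => ?_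
    rw [map_smulₛₗ, Complex.conj_ofReal,
      (isStarProjection_densityProj ψ μ).isSelfAdjoint.adjoint_eq]
  have hAA : A * A = ∑ μ ∈ t.erase 0, (c μ : ℂ) • P μ := by
    rw [Finset.sum_mul]
    refine Finset.sum_congr rfl fun μ hμ => ?_
    rw [Finset.mul_sum, Finset.sum_eq_single μ _ (fun h => absurd hμ h)]
    · rw [smul_mul_smul_comm, (isStarProjection_densityProj ψ μ).isIdempotentElem.eq,
        ← Complex.ofReal_mul, Real.mul_self_sqrt (hc μ)]
    · intro ν _ hν
      rw [smul_mul_smul_comm, densityProj_mul_of_ne ψ hν.symm, smul_zero]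
  have hinner : ∀ (S : H →L[ℂ] H) (T : K →L[ℂ] K), Commute S A →
      inner ℂ (tensorOp A 1 ψ) (tensorOp S T (tensorOp A 1 ψ))
        = ∑ μ ∈ t.erase 0, (c μ : ℂ) * inner ℂ ψ (tensorOp S T (tensorOp (P μ) 1 ψ)) := by
    intro S T hS
    rw [← adjoint_inner_right, adjoint_tensorOp, hA, ← star_eq_adjoint (1 : K →L[ℂ] K), star_one,
      tensorOp_tensorOp, tensorOp_tensorOp, one_mul, mul_one, ← hS.eq, mul_assoc, hAA,
      Finset.mul_sum, tensorOp_sum_left, sum_apply, inner_sum]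
    refine Finset.sum_congr rfl fun μ _ => ?_
    rw [mul_smul_comm, tensorOp_smul_left, smul_apply, inner_smul_right, tensorOp_tensorOp, mul_one]
  refine ⟨A, ?_, hEA, ?_, fun a b x y => ?_⟩
  · have hfin : ∀ μ ∈ t.erase 0, FiniteDimensional ℂ (P μ).range := fun μ hμ =>
      finiteDimensional_range_densityProj ψ (Finset.ne_of_mem_erase hμ)
    have hle : A.range ≤ (t.erase 0).sup fun μ => (P μ).range := by
      rintro _ ⟨z, rfl⟩
      change A z ∈ _
      rw [sum_apply]
      exact Submodule.sum_mem _ fun μ hμ =>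
        Finset.le_sup (f := fun μ => (P μ).range) hμ (Submodule.smul_mem _ _ ⟨z, rfl⟩)
    have : FiniteDimensional ℂ ((t.erase 0).sup fun μ => (P μ).range : Submodule ℂ H) := by
      rw [← Submodule.fg_iff_finiteDimensional]
      exact Submodule.fg_finset_sup _ _ fun μ hμ =>
        (Submodule.fg_iff_finiteDimensional _).2 (hfin μ hμ)
    exact Submodule.finiteDimensional_of_le hle
  · have h := hinner 1 1 (Commute.one_left A)
    have h' := congrArg Prod.snd hsc'
    simp only [tensorOp_one] at h
    simp only [Prod.snd_sum, Prod.smul_snd, Complex.real_smul, s] at h'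
    have h'' : inner ℂ (tensorOp A 1 ψ) (tensorOp A 1 ψ) = inner ℂ ψ ψ := h.trans h'
    rw [inner_self_eq_norm_sq_to_K, inner_self_eq_norm_sq_to_K] at h''
    exact (pow_left_inj₀ (norm_nonneg _) (norm_nonneg _) two_ne_zero).1 (by exact_mod_cast h'')
  · have h' := congrArg (fun q => q.1 a b x y) hsc'
    simp only [Prod.fst_sum, Prod.smul_fst, Finset.sum_apply, Pi.smul_apply, Complex.real_smul, s]
      at h'
    exact (hinner (E x a) (F y b) (hEA x a)).trans h'

theorem syncCqs_subset_syncCq (n m : ℕ) : syncCqs.{u} n m ⊆ syncCq.{v} n m := by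
  rintro p ⟨⟨H, K, _, _, _, _, _, _, E, F, ψ, hE, hF, hψ, h⟩, hp⟩
  refine ⟨?_, hp⟩
  have hEF := tensorOp_eq_of_isSynchronous hp hE hF h
  obtain ⟨A, hfin, hEA, hnorm, hA⟩ := exists_finiteRank_state hE hF hEF
  refine mem_Cq_of_finiteDimensional hE hF A.range (φ := tensorOp A 1 ψ) ?_ ?_ (hnorm.trans hψ) ?_
    fun a b x y => (h a b x y).trans (hA a b x y).symm
  · rintro x a _ ⟨z, rfl⟩
    exact ⟨E x a z, (congrArg (fun T : H →L[ℂ] H => T z) (hEA x a).eq).symm⟩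
  · rw [tensorOp_tensorOp, one_mul]
    congr 2
    ext z
    exact Submodule.starProjection_eq_self_iff.2 ⟨z, rfl⟩
  · intro x a
    rw [tensorOp_tensorOp, (hEA x a).eq, ← tensorOp_tensorOp, hEF, tensorOp_tensorOp,
      tensorOp_tensorOp, one_mul, mul_one, one_mul, mul_one]

theorem syncCq_subset_syncCqs (n m : ℕ) : syncCq.{u} n m ⊆ syncCqs.{u} n m := by
  rintro p ⟨⟨H, K, i₁, i₂, i₃, i₄, i₅, i₆, _, _, h⟩, hp⟩
  exact ⟨⟨H, K, i₁, i₂, i₃, i₄, i₅, i₆, h⟩, hp⟩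

end Synchronous

end QuantumCorrelation

/-- The universes of the Hilbert spaces on the two sides are arbitrary and independent. -/
theorem mainTheorem4 (n m : ℕ) :
    QuantumCorrelation.syncCq.{u} n m = QuantumCorrelation.syncCqs.{v} n m :=
  Set.Subset.antisymm
    (((QuantumCorrelation.syncCq_subset_syncCqs n m).trans
      (QuantumCorrelation.syncCqs_subset_syncCq n m)).trans
        (QuantumCorrelation.syncCq_subset_syncCqs n m))
    (QuantumCorrelation.syncCqs_subset_syncCq n m)
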